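/- Let $(S,\mathfrak m,k)$ and $(T,\mathfrak n,k)$ be commutative Noetherian local rings with a common residue field $k$, let $\pi_S\colon S\twoheadrightarrow k$ and $\pi_T\colon T\twoheadrightarrow k$ be the natural surjections, and assume that neither $\pi_S$ nor $\pi_T$ is an isomorphism (that is, $\mathfrak m\neq 0\neq\mathfrak n$). Let $$R = S\times_k T=\{(s,t)\in S\times T \mid \pi_S(s)=\pi_T(t)\}$$ be their fiber product. Let $M$ and $N$ be finitely generated $R$-modules such that $$\operatorname{Tor}^R_{2i+1}(M,N)=0=\operatorname{Tor}^R_{2j}(M,N)$$ for some integers $i\ge 2$ and $j\ge 3$. Then $\operatorname{pd}_R M\le 1$ or $\operatorname{pd}_R N\le 1$. -/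

import Mathlib

universe u v w

/-- The fiber product `S ×ₖ T = {(s, t) ∈ S × T | πS s = πT t}`, as a subring of `S × T`. -/
abbrev FiberProduct {S : Type u} {T : Type v} {k : Type w} [CommRing S] [CommRing T] [Field k]
    (πS : S →+* k) (πT : T →+* k) : Type (max u v) :=
  RingHom.pullback πS πT

/-- The `R`-module `Tor_n^R(M, N)`: the `n`-th left derived functor of `M ⊗[R] -`, applied
to `N`. -/
noncomputable abbrev TorModule (R : Type u) [CommRing R] (n : ℕ) (M N : Type u)
    [AddCommGroup M] [AddCommGroup N] [Module R M] [Module R N] : ModuleCat.{u} R :=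
  ((CategoryTheory.Tor (ModuleCat.{u} R) n).obj (ModuleCat.of R M)).obj (ModuleCat.of R N)

/-! The maximal ideal of the fiber product splits as 𝔪 = I ⊕ J, where I and J are nonzero copies of
the maximal ideals of S and T, and IJ = 0. Let X be a second syzygy of N, minimal in the last step.
Splitting coordinates gives X = X_I ⊕ X_J, with X_I killed by J and X_J by I
(`exists_retraction_coordinatesIn`). If X = 0, then pd N ≤ 1. Otherwise some summand C is nonzero,
say with JC = 0, and Tor(M, C) vanishes in degrees 2i - 1 and 2j - 2.

A nonzero finite C killed by J has J as a summand of its minimal syzygy, so a vanishing Tor(M, C)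
passes to Tor(M, J) one degree lower (`subsingleton_torModule_ideal_of_smul_eq_zero`). Since J kills
I and I kills J, the descent continues, alternating between I and J. Because the two starting
degrees differ in parity, one descent ends at Tor₁(M, J) and the other at Tor₁(M, I). Hence Tor₁(M,
𝔪) = 0, and the local criterion for freeness gives pd M ≤ 1. -/

open CategoryTheory Limits

/-! ### Dimension shifting for left derived functors -/

namespace CategoryTheory

variable {C : Type u} [Category.{v} C] [Abelian C] {D : Type*} [Category* D] [Abelian D]

/-- The augmentation of a projective resolution. -/
def ProjectiveResolution.augmentation {Z : C} (P : ProjectiveResolution Z) : P.complex.X 0 ⟶ Z :=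
  P.π.f 0

instance {Z : C} (P : ProjectiveResolution Z) : Epi P.augmentation :=
  inferInstanceAs (Epi (P.π.f 0))

@[simp]
theorem ProjectiveResolution.d_augmentation {Z : C} (P : ProjectiveResolution Z) :
    P.complex.d 1 0 ≫ P.augmentation = 0 :=
  P.complex_d_comp_π_f_zero

theorem ProjectiveResolution.d_augmentation_comp {Z Y : C} (P : ProjectiveResolution Z)
    (f : Z ⟶ Y) : P.complex.d 1 0 ≫ P.augmentation ≫ f = 0 := by
  rw [← Category.assoc, P.d_augmentation, zero_comp]

theorem ProjectiveResolution.exact_augmentation {Z : C} (P : ProjectiveResolution Z) :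
    (ShortComplex.mk _ _ P.d_augmentation).Exact :=
  P.exact₀

theorem ProjectiveResolution.augmentation_comp_comp {S : ShortComplex C}
    (P : ProjectiveResolution S.X₁) : (P.augmentation ≫ S.f) ≫ S.g = 0 := by
  rw [Category.assoc, S.zero, comp_zero]

/-- A projective resolution of the kernel of an epimorphism `S.g` with projective source extends to
a projective resolution of its target. -/
noncomputable def ProjectiveResolution.ofShortExact {S : ShortComplex C} (hS : S.ShortExact)
    (h₂ : Projective S.X₂) (P : ProjectiveResolution S.X₁) : ProjectiveResolution S.X₃ where
  complex := P.complex.augment (P.augmentation ≫ S.f) (P.d_augmentation_comp S.f)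
  projective n := by
    cases n
    · exact h₂
    · exact P.projective _
  π := (ChainComplex.toSingle₀Equiv _ _).symm ⟨S.g, P.augmentation_comp_comp⟩
  quasiIso := ⟨fun n => by
    have := hS.mono_f
    have := hS.epi_g
    rcases n with _ | _ | n
    · rw [ChainComplex.quasiIsoAt₀_iff, ShortComplex.quasiIso_iff_of_zeros']
      · dsimp
        refine (ShortComplex.exact_and_epi_g_iff_of_iso (?_ : _ ≅
          ShortComplex.mk (P.augmentation ≫ S.f) S.g (by simp))).2 ⟨?_, ‹_›⟩
        · exact ShortComplex.isoMk (Iso.refl _) (Iso.refl _) (Iso.refl _)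
            ((Category.id_comp _).trans (Category.comp_id _).symm)
            ((Category.id_comp _).trans (Eq.trans
              (ChainComplex.toSingle₀Equiv_symm_apply_f_zero (X := S.X₃)
                (C := P.complex.augment (P.augmentation ≫ S.f) (P.d_augmentation_comp S.f))
                S.g P.augmentation_comp_comp).symm
              (Category.comp_id _).symm))
        -- Precomposing with the epimorphism `P.augmentation` does not change the image of `S.f`.
        · let α : ShortComplex.mk (P.augmentation ≫ S.f) S.g (by simp) ⟶ S :=
            { τ₁ := P.augmentation
              τ₂ := 𝟙 _
              τ₃ := 𝟙 _ }
          have : Epi α.τ₁ := inferInstanceAs (Epi (P.augmentation))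
          have : IsIso α.τ₂ := inferInstanceAs (IsIso (𝟙 _))
          have : Mono α.τ₃ := inferInstanceAs (Mono (𝟙 _))
          exact (ShortComplex.exact_iff_of_epi_of_isIso_of_mono α).2 hS.exact
      all_goals rfl
    · rw [quasiIsoAt_iff_exactAt']
      · rw [HomologicalComplex.exactAt_iff' _ 2 1 0 (by simp) (by simp)]
        -- Postcomposing with the monomorphism `S.f` does not change the kernel of the augmentation.
        let α : ShortComplex.mk _ _ P.d_augmentation ⟶
            (P.complex.augment (P.augmentation ≫ S.f) (P.d_augmentation_comp S.f)).sc' 2 1 0 :=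
          { τ₁ := 𝟙 (P.complex.X 1)
            τ₂ := 𝟙 (P.complex.X 0)
            τ₃ := S.f
            comm₁₂ := (Category.id_comp _).trans (Category.comp_id _).symm
            comm₂₃ := Category.id_comp _ }
        have : Epi α.τ₁ := inferInstanceAs (Epi (𝟙 _))
        have : IsIso α.τ₂ := inferInstanceAs (IsIso (𝟙 _))
        have : Mono α.τ₃ := inferInstanceAs (Mono S.f)
        exact (ShortComplex.exact_iff_of_epi_of_isIso_of_mono α).1 P.exact_augmentation
      · apply ChainComplex.exactAt_succ_single_obj
    · rw [quasiIsoAt_iff_exactAt']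
      · rw [HomologicalComplex.exactAt_iff' _ (n + 3) (n + 2) (n + 1) (by simp) (by simp)]
        exact P.exact_succ n
      · apply ChainComplex.exactAt_succ_single_obj⟩

variable [HasProjectiveResolutions C]

/-- A higher left derived functor vanishes exactly where the image of a resolution is exact. -/
theorem ProjectiveResolution.isZero_leftDerived_succ_iff {X : C} (P : ProjectiveResolution X)
    (F : C ⥤ D) [F.Additive] (n : ℕ) :
    IsZero ((F.leftDerived (n + 1)).obj X) ↔
      (ShortComplex.mk (F.map (P.complex.d (n + 2) (n + 1))) (F.map (P.complex.d (n + 1) n))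
        (by rw [← F.map_comp, HomologicalComplex.d_comp_d, F.map_zero])).Exact := by
  rw [(P.isoLeftDerivedObj F (n + 1)).isZero_iff]
  refine (HomologicalComplex.exactAt_iff_isZero_homology _ _).symm.trans ?_
  exact HomologicalComplex.exactAt_iff' _ (n + 2) (n + 1) n (by simp) (by simp)

/-- Dimension shifting for left derived functors. -/
theorem Functor.isZero_leftDerived_of_shortExact (F : C ⥤ D) [F.Additive] {S : ShortComplex C}
    (hS : S.ShortExact) (h₂ : Projective S.X₂) (n : ℕ)
    (h : IsZero ((F.leftDerived (n + 2)).obj S.X₃)) :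
    IsZero ((F.leftDerived (n + 1)).obj S.X₁) := by
  let P := projectiveResolution S.X₁
  rw [(ProjectiveResolution.ofShortExact hS h₂ P).isZero_leftDerived_succ_iff F (n + 1)] at h
  exact (P.isZero_leftDerived_succ_iff F n).2 h

/-- If the first left derived functor of a right exact functor vanishes at `S.X₃`, then the functor
preserves the monomorphism of a short exact sequence with projective middle term. -/
theorem Functor.mono_map_of_isZero_leftDerived_one (F : C ⥤ D) [F.Additive]
    [PreservesFiniteColimits F] {S : ShortComplex C}
    (hS : S.ShortExact) (h₂ : Projective S.X₂) (h : IsZero ((F.leftDerived 1).obj S.X₃)) :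
    Mono (F.map S.f) := by
  let P := projectiveResolution S.X₁
  rw [(ProjectiveResolution.ofShortExact hS h₂ P).isZero_leftDerived_succ_iff F 0] at h
  have h' : (ShortComplex.mk (F.map (P.complex.d 1 0)) (F.map (P.augmentation ≫ S.f))
    (by rw [← F.map_comp, P.d_augmentation_comp, F.map_zero])).Exact := h
  have he : Epi (F.map (P.augmentation)) := inferInstance
  -- An element killed by `F.map S.f` lifts along the augmentation to a cycle, hence to a boundary,
  -- which the augmentation kills.
  refine Preadditive.mono_of_cancel_zero _ fun {A} g hg ↦ ?_
  obtain ⟨A', π, hπ, x, hx⟩ := surjective_up_to_refinements_of_epi (F.map (P.augmentation)) g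
  have hx' : x ≫ F.map (P.augmentation ≫ S.f) = 0 := by
    rw [F.map_comp, ← Category.assoc, ← hx, Category.assoc, hg, comp_zero]
  obtain ⟨A'', π', hπ', y, hy⟩ := h'.exact_up_to_refinements x hx'
  dsimp at y hy
  rw [← cancel_epi π, ← cancel_epi π', hx, ← Category.assoc, hy, Category.assoc, ← F.map_comp,
    P.d_augmentation]
  simp

/-- Lifts of morphisms to resolutions are unique up to homotopy, so a sum of lifts represents the
lift of the sum. This makes left derived functors additive, as needed to split Tor over direct sums.
-/
instance : (projectiveResolutions C).Additive where
  map_add {X Y f g} := by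
    refine Eq.trans ?_ (HomotopyCategory.quotient C (ComplexShape.down ℕ)).map_add
    apply HomotopyCategory.eq_of_homotopy
    apply ProjectiveResolution.liftHomotopy (f + g)
    · simp
    · simp [Preadditive.add_comp]

instance (F : C ⥤ D) [F.Additive] (n : ℕ) : (F.leftDerived n).Additive := by
  unfold Functor.leftDerived Functor.leftDerivedToHomotopyCategory
  infer_instance

end CategoryTheory

open TensorProduct

/-! ### Tor of modules: retracts and syzygies -/

section Tor

variable {R : Type u} [CommRing R]

theorem subsingleton_torModule_iff_isZero (n : ℕ) (M N : Type u) [AddCommGroup M]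
    [AddCommGroup N] [Module R M] [Module R N] :
    Subsingleton (TorModule R n M N) ↔
      IsZero ((((MonoidalCategory.tensoringLeft (ModuleCat.{u} R)).obj
        (ModuleCat.of R M)).leftDerived n).obj (ModuleCat.of R N)) :=
  (ModuleCat.isZero_iff_subsingleton).symm

/-- If the identity of `X` is a sum of endomorphisms that factor through `Y` and `Z`, and
`Tor_n(M, -)` vanishes at `Y` and `Z`, then it vanishes at `X`. -/
theorem subsingleton_torModule_of_add_eq_id {M X Y Z : Type u} [AddCommGroup M] [AddCommGroup X]
    [AddCommGroup Y] [AddCommGroup Z] [Module R M] [Module R X] [Module R Y] [Module R Z]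
    (f : X →ₗ[R] Y) (f' : Y →ₗ[R] X) (g : X →ₗ[R] Z) (g' : Z →ₗ[R] X)
    (h : f' ∘ₗ f + g' ∘ₗ g = LinearMap.id) (n : ℕ)
    (hY : Subsingleton (TorModule R n M Y)) (hZ : Subsingleton (TorModule R n M Z)) :
    Subsingleton (TorModule R n M X) := by
  rw [subsingleton_torModule_iff_isZero] at hY hZ ⊢
  set F := ((MonoidalCategory.tensoringLeft (ModuleCat.{u} R)).obj (ModuleCat.of R M)).leftDerived n
  have h' : ModuleCat.ofHom f ≫ ModuleCat.ofHom f' + ModuleCat.ofHom g ≫ ModuleCat.ofHom g' =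
      𝟙 (ModuleCat.of R X) := by
    ext x
    exact LinearMap.congr_fun h x
  rw [IsZero.iff_id_eq_zero, ← F.map_id, ← h', F.map_add, F.map_comp, F.map_comp,
    hY.eq_of_tgt (F.map (ModuleCat.ofHom f)) 0, hZ.eq_of_tgt (F.map (ModuleCat.ofHom g)) 0]
  simp

/-- If `Tor_n(M, -)` vanishes at a module, it vanishes at each of its retracts. -/
theorem subsingleton_torModule_of_retract {M X Y : Type u} [AddCommGroup M] [AddCommGroup X]
    [AddCommGroup Y] [Module R M] [Module R X] [Module R Y]
    (f : X →ₗ[R] Y) (r : Y →ₗ[R] X) (h : r ∘ₗ f = LinearMap.id) (n : ℕ)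
    (hY : Subsingleton (TorModule R n M Y)) : Subsingleton (TorModule R n M X) :=
  subsingleton_torModule_of_add_eq_id f r f 0 (by simpa using h) n hY hY

variable {K F N : Type u} [AddCommGroup K] [AddCommGroup F] [AddCommGroup N] [Module R K]
  [Module R F] [Module R N] {f : K →ₗ[R] F} {g : F →ₗ[R] N}

/-- The short exact sequence in `ModuleCat` given by linear maps. -/
theorem shortExact_of_exact (hf : Function.Injective f) (hg : Function.Surjective g)
    (h : Function.Exact f g) :
    (ShortComplex.mk (ModuleCat.ofHom f) (ModuleCat.ofHom g)
      (by ext x; exact h.apply_apply_eq_zero x)).ShortExact where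
  exact := (ShortComplex.ShortExact.moduleCat_exact_iff_function_exact _).2 h
  mono_f := (ModuleCat.mono_iff_injective _).2 hf
  epi_g := (ModuleCat.epi_iff_surjective _).2 hg

/-- Dimension shifting in the second variable of `Tor`. -/
theorem subsingleton_torModule_of_exact (hf : Function.Injective f) (hg : Function.Surjective g)
    (h : Function.Exact f g) [Module.Projective R F] {M : Type u} [AddCommGroup M] [Module R M]
    {n : ℕ} (hN : Subsingleton (TorModule R (n + 2) M N)) :
    Subsingleton (TorModule R (n + 1) M K) := by
  rw [subsingleton_torModule_iff_isZero] at hN ⊢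
  exact Functor.isZero_leftDerived_of_shortExact _ (shortExact_of_exact hf hg h)
    (ModuleCat.projective_of_categoryTheory_projective _) n hN

/-- If `Tor₁(M, N) = 0`, tensoring a projective presentation of `N` with `M` is left exact. -/
theorem lTensor_injective_of_subsingleton_torModule_one (hf : Function.Injective f)
    (hg : Function.Surjective g) (h : Function.Exact f g) [Module.Projective R F] {M : Type u}
    [AddCommGroup M] [Module R M] (hN : Subsingleton (TorModule R 1 M N)) :
    Function.Injective (f.lTensor M) := by
  rw [subsingleton_torModule_iff_isZero] at hN
  have := Functor.mono_map_of_isZero_leftDerived_one _ (shortExact_of_exact hf hg h)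
    (ModuleCat.projective_of_categoryTheory_projective _) hN
  exact (ModuleCat.mono_iff_injective _).1 this

/-- A module with a projective resolution of length one has projective dimension at most one. -/
theorem projectiveDimension_le_one_of_exact (hf : Function.Injective f)
    (hg : Function.Surjective g) (h : Function.Exact f g) [Module.Projective R F]
    [Module.Projective R K] : projectiveDimension (ModuleCat.of R N) ≤ 1 := by
  have hF : Projective (ModuleCat.of R F) := inferInstance
  have hK : Projective (ModuleCat.of R K) := inferInstance
  rw [← Nat.cast_one, projectiveDimension_le_iff]
  exact ((shortExact_of_exact hf hg h).hasProjectiveDimensionLT_X₃_iff 0 hF).2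
    (projective_iff_hasProjectiveDimensionLT_one.1 hK)

end Tor

open IsLocalRing

/-! ### Minimal covers and a Tor criterion for projective dimension at most one -/

section Local

variable {R : Type u} [CommRing R] [IsLocalRing R]

/-- A finite module over a local ring has a minimal free cover. -/
theorem exists_minimal_free_cover (N : Type v) [AddCommGroup N] [Module R N] [Module.Finite R N] :
    ∃ (n : ℕ) (φ : (Fin n → R) →ₗ[R] N), Function.Surjective φ ∧
      ∀ v ∈ LinearMap.ker φ, ∀ i, v i ∈ maximalIdeal R := by
  let b := Module.finBasis (ResidueField R) (ResidueField R ⊗[R] N)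
  have hs : Function.Surjective (TensorProduct.mk R (ResidueField R) N 1) :=
    TensorProduct.mk_surjective R N _ Ideal.Quotient.mk_surjective
  choose g hg using fun i => hs (b i)
  refine ⟨_, Fintype.linearCombination R g, ?_, fun v hv i => ?_⟩
  · rw [← LinearMap.range_eq_top, Fintype.range_linearCombination]
    exact span_eq_top_of_tmul_eq_basis g b hg
  · have h := congrArg (TensorProduct.mk R (ResidueField R) N 1) (LinearMap.mem_ker.1 hv)
    rw [Fintype.linearCombination_apply, map_sum, map_zero] at h
    simp only [map_smul, hg] at h
    have h' : ∑ i, residue R (v i) • b i = 0 := by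
      rw [← h]
      exact Finset.sum_congr rfl fun i _ => algebraMap_smul _ _ _
    rw [← residue_eq_zero_iff]
    exact Fintype.linearIndependent_iff.1 b.linearIndependent _ h' i

/-- A finite module `M` over a Noetherian local ring with `Tor₁(M, 𝔪) = 0` has projective dimension
at most one. -/
theorem projectiveDimension_le_one_of_torModule_maximalIdeal [IsNoetherianRing R] {M : Type u}
    [AddCommGroup M] [Module R M] [Module.Finite R M]
    (h : Subsingleton (TorModule R 1 M (maximalIdeal R))) :
    projectiveDimension (ModuleCat.of R M) ≤ 1 := by
  obtain ⟨n, φ, hφ⟩ := Module.Finite.exists_fin' R M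
  obtain ⟨l, ψ, hψ⟩ := Module.Finite.exists_fin' R (maximalIdeal R)
  have hL := lTensor_injective_of_subsingleton_torModule_one (LinearMap.ker ψ).injective_subtype
    hψ (LinearMap.exact_subtype_ker_map ψ) h
  -- Balancing Tor₁ by hand: the vanishing moves from the presentation of 𝔪 to that of M.
  have hinj : Function.Injective ((LinearMap.ker φ).subtype.lTensor (maximalIdeal R)) :=
    lTensor_injective_of_exact_of_exact_of_rTensor_injective (LinearMap.exact_subtype_ker_map ψ) hψ
      (LinearMap.exact_subtype_ker_map φ) hφ ((LinearMap.lTensor_inj_iff_rTensor_inj _ _).1 hL)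
      (Module.Flat.lTensor_preserves_injective_linearMap _ (LinearMap.ker φ).injective_subtype)
  -- With K = ker φ, the injective map 𝔪 ⊗ K → 𝔪 ⊗ Rⁿ → R ⊗ Rⁿ factors through 𝔪 ⊗ K → R ⊗ K.
  have hinj' : Function.Injective ((maximalIdeal R).subtype.rTensor (LinearMap.ker φ)) := by
    have := (Module.Flat.rTensor_preserves_injective_linearMap (M := Fin n → R)
      (maximalIdeal R).subtype (maximalIdeal R).injective_subtype).comp hinj
    rw [← LinearMap.coe_comp, LinearMap.rTensor_comp_lTensor, ← LinearMap.lTensor_comp_rTensor,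
      LinearMap.coe_comp] at this
    exact this.of_comp
  have := Module.finitePresentation_of_finite R (LinearMap.ker φ)
  have := Module.free_of_maximalIdeal_rTensor_injective hinj'
  exact projectiveDimension_le_one_of_exact (LinearMap.ker φ).injective_subtype hφ
    (LinearMap.exact_subtype_ker_map φ)

end Local

/-! ### Ideals with zero intersection and coordinates -/

section Coordinates

variable {R : Type u} [CommRing R] {I J : Ideal R}

theorem smul_eq_zero_of_inf_eq_bot (hinf : I ⊓ J = ⊥) (x : R) (hx : x ∈ I) (y : J) : x • y = 0 := by
  have : x * y ∈ I ⊓ J := ⟨I.mul_mem_right _ hx, J.mul_mem_left _ y.2⟩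
  rw [hinf, Ideal.mem_bot] at this
  exact Subtype.ext this

/-- The elements of a submodule of a free module with all coordinates in a given ideal. -/
def Submodule.coordinatesIn {ι : Type*} (K : Submodule R (ι → R)) (I : Ideal R) :
    Submodule R (ι → R) :=
  K ⊓ Submodule.pi Set.univ fun _ => I

theorem Submodule.mem_coordinatesIn {ι : Type*} {K : Submodule R (ι → R)} {v : ι → R} :
    v ∈ K.coordinatesIn I ↔ v ∈ K ∧ ∀ i, v i ∈ I := by
  simp [coordinatesIn]

theorem Submodule.smul_coordinatesIn_eq_zero {ι : Type*} (hinf : I ⊓ J = ⊥)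
    (K : Submodule R (ι → R)) (x : R) (hx : x ∈ I) (v : K.coordinatesIn J) : x • v = 0 := by
  ext i
  exact congrArg Subtype.val
    (smul_eq_zero_of_inf_eq_bot hinf x hx ⟨_, (mem_coordinatesIn.1 v.2).2 i⟩)

end Coordinates

/-! ### Local rings whose maximal ideal is I ⊕ J -/

section Decomposition

variable {R : Type u} [CommRing R] [IsLocalRing R] {I J : Ideal R}

/-- The projection of `𝔪 = I ⊕ J` onto `J`. -/
theorem exists_projection_maximalIdeal (hinf : I ⊓ J = ⊥) (hsup : I ⊔ J = maximalIdeal R) :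
    ∃ e : maximalIdeal R →ₗ[R] J, ∀ x : maximalIdeal R, (x : R) - e x ∈ I := by
  have hI : I ≤ maximalIdeal R := hsup ▸ le_sup_left
  have hJ : J ≤ maximalIdeal R := hsup ▸ le_sup_right
  let s : (I × J) →ₗ[R] maximalIdeal R :=
    (Submodule.inclusion hI).coprod (Submodule.inclusion hJ)
  have hs : ∀ p, (s p : R) = p.1 + p.2 := fun p => by simp [s]
  have hbij : Function.Bijective s := by
    constructor
    · rw [injective_iff_map_eq_zero]
      rintro ⟨a, b⟩ hab
      have h := hs (a, b)
      rw [hab, ZeroMemClass.coe_zero] at h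
      have ha : (a : R) = 0 := by
        have : (a : R) ∈ I ⊓ J := ⟨a.2, by
          rw [eq_neg_of_add_eq_zero_left h.symm]
          exact J.neg_mem b.2⟩
        simpa [hinf] using this
      rw [ha, zero_add] at h
      exact Prod.ext (Subtype.ext ha) (Subtype.ext h.symm)
    · rintro ⟨x, hx⟩
      rw [← hsup] at hx
      obtain ⟨a, ha, b, hb, rfl⟩ := Submodule.mem_sup.1 hx
      exact ⟨(⟨a, ha⟩, ⟨b, hb⟩), Subtype.ext (hs _)⟩
  refine ⟨LinearMap.snd R I J ∘ₗ (LinearEquiv.ofBijective s hbij).symm, fun x => ?_⟩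
  obtain ⟨p, rfl⟩ := hbij.2 x
  have : (LinearEquiv.ofBijective s hbij).symm (s p) = p :=
    (LinearEquiv.ofBijective s hbij).symm_apply_apply p
  simp [this, hs]

theorem apply_eq_of_sub_mem {e : maximalIdeal R →ₗ[R] J} (hinf : I ⊓ J = ⊥)
    (he : ∀ x : maximalIdeal R, (x : R) - e x ∈ I) (x : maximalIdeal R) (hx : (x : R) ∈ J) :
    (e x : R) = x := by
  have : (x : R) - e x ∈ I ⊓ J := ⟨he x, J.sub_mem hx (e x).2⟩
  rw [hinf, Ideal.mem_bot, sub_eq_zero] at this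
  exact this.symm

/-- If `𝔪 = I ⊕ J` and `C` is a nonzero finite module killed by `J`, then `J` is a direct summand
of the minimal syzygy of `C`, so that `Tor_{n+2}(M, C) = 0` forces `Tor_{n+1}(M, J) = 0`. -/
theorem subsingleton_torModule_ideal_of_smul_eq_zero (hinf : I ⊓ J = ⊥)
    (hsup : I ⊔ J = maximalIdeal R) {M C : Type u} [AddCommGroup M] [Module R M] [AddCommGroup C]
    [Module R C] [Module.Finite R C] [Nontrivial C] (hC : ∀ y ∈ J, ∀ c : C, y • c = 0) {n : ℕ}
    (h : Subsingleton (TorModule R (n + 2) M C)) : Subsingleton (TorModule R (n + 1) M J) := by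
  obtain ⟨e, he⟩ := exists_projection_maximalIdeal hinf hsup
  have hJ : J ≤ maximalIdeal R := hsup ▸ le_sup_right
  obtain ⟨l, φ, hφ, hmin⟩ := exists_minimal_free_cover (R := R) C
  obtain ⟨i⟩ : Nonempty (Fin l) := by
    by_contra hl
    rw [not_nonempty_iff] at hl
    exact not_subsingleton C hφ.subsingleton
  -- J embeds in the `i`-th coordinate, inside the syzygy because J kills C. By minimality that
  -- coordinate of any syzygy lies in 𝔪, so `e` retracts it onto J.
  refine subsingleton_torModule_of_retract (Y := LinearMap.ker φ)
    (((LinearMap.single R (fun _ : Fin l => R) i).restrict fun y (hy : y ∈ J) => ?_) :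
      J →ₗ[R] LinearMap.ker φ)
    (e ∘ₗ ((LinearMap.proj i).restrict fun v (hv : v ∈ LinearMap.ker φ) => hmin v hv i)) ?_ _
    (subsingleton_torModule_of_exact (LinearMap.ker φ).injective_subtype hφ
      (LinearMap.exact_subtype_ker_map φ) h)
  · have : (LinearMap.single R (fun _ : Fin l => R) i) y = y • Pi.single i 1 := by
      rw [LinearMap.single_apply, ← Pi.single_smul, smul_eq_mul, mul_one]
    rw [LinearMap.mem_ker, this, map_smul, hC y hy]
  · ext y
    have hy : (Pi.single i (y : R) : Fin l → R) i = y := by simp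
    exact (apply_eq_of_sub_mem hinf he
      ⟨(Pi.single i (y : R) : Fin l → R) i, by rw [hy]; exact hJ y.2⟩ (Set.mem_of_eq_of_mem hy y.2)).trans hy

/-- If `𝔪 = I ⊕ J`, the elements with all coordinates in `J` form a direct summand of a second
syzygy that is minimal in the last step. If this summand is zero, all elements have their coordinates in `I`. -/
theorem exists_retraction_coordinatesIn (hinf : I ⊓ J = ⊥) (hsup : I ⊔ J = maximalIdeal R)
    {l n : ℕ} {K' : Submodule R (Fin n → R)}
    {ψ : (Fin l → R) →ₗ[R] K'} (hψ : ∀ v ∈ LinearMap.ker ψ, ∀ i, v i ∈ maximalIdeal R) :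
    ∃ (f : (LinearMap.ker ψ).coordinatesIn J →ₗ[R] LinearMap.ker ψ)
      (r : LinearMap.ker ψ →ₗ[R] (LinearMap.ker ψ).coordinatesIn J),
      r ∘ₗ f = LinearMap.id ∧ ∀ (v : LinearMap.ker ψ) (i : Fin l), (v : Fin l → R) i - (r v : Fin l → R) i ∈ I := by
  obtain ⟨e, he⟩ := exists_projection_maximalIdeal hinf hsup
  let P : LinearMap.ker ψ →ₗ[R] (Fin l → R) := LinearMap.pi fun i =>
    J.subtype ∘ₗ e ∘ₗ ((LinearMap.proj i).restrict fun v (hv : v ∈ LinearMap.ker ψ) => hψ v hv i)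
  have hPJ : ∀ v i, P v i ∈ J := fun v i => (e _).2
  have hPI : ∀ (v : LinearMap.ker ψ) (i : Fin l), (v : Fin l → R) i - P v i ∈ I := fun v i => he ⟨_, hψ v v.2 i⟩
  have hcoord : ∀ (L : Ideal R) (w : Fin l → R), (∀ i, w i ∈ L) → ∀ k, (ψ w : Fin n → R) k ∈ L := by
    intro L w hw k
    rw [pi_eq_sum_univ' w, map_sum, AddSubmonoidClass.coe_finsetSum, Finset.sum_apply]
    refine L.sum_mem fun i _ => ?_
    rw [map_smul]
    exact L.mul_mem_right _ (hw i)
  -- Since ψ v = 0, the coordinates of ψ (P v) = -ψ (v - P v) lie in both J and I. This uses that ψ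
  -- takes values in a free module, hence a second syzygy.
  have hPK : ∀ v, P v ∈ LinearMap.ker ψ := by
    intro v
    rw [LinearMap.mem_ker]
    ext k
    have h₁ := hcoord J _ (hPJ v) k
    have h₂ := hcoord I (v - P v) (hPI v) k
    rw [map_sub, LinearMap.mem_ker.1 v.2, zero_sub] at h₂
    have : (ψ (P v) : Fin n → R) k ∈ I ⊓ J := ⟨by simpa using h₂, h₁⟩
    simpa [hinf] using this
  refine ⟨Submodule.inclusion inf_le_left, P.codRestrict _ fun v =>
    Submodule.mem_coordinatesIn.2 ⟨hPK v, hPJ v⟩, ?_, hPI⟩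
  ext v i
  exact apply_eq_of_sub_mem hinf he _ ((Submodule.mem_coordinatesIn.1 v.2).2 i)

variable [IsNoetherianRing R]

/-- Two shifts, from J to I (as I kills J) and back to J (as J kills I), lower the degree by 2. -/
theorem subsingleton_torModule_ideal_odd (hinf : I ⊓ J = ⊥) (hsup : I ⊔ J = maximalIdeal R)
    (hI : I ≠ ⊥) (hJ : J ≠ ⊥) {M : Type u} [AddCommGroup M] [Module R M] (p : ℕ)
    (h : Subsingleton (TorModule R (2 * p + 1) M J)) : Subsingleton (TorModule R 1 M J) := by
  have : Nontrivial I := Submodule.nontrivial_iff_ne_bot.2 hI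
  have : Nontrivial J := Submodule.nontrivial_iff_ne_bot.2 hJ
  have hinf' : J ⊓ I = ⊥ := inf_comm I J ▸ hinf
  induction p with
  | zero => exact h
  | succ p ih =>
    refine ih (subsingleton_torModule_ideal_of_smul_eq_zero hinf hsup (C := I)
      (smul_eq_zero_of_inf_eq_bot hinf') ?_)
    exact subsingleton_torModule_ideal_of_smul_eq_zero hinf' (sup_comm I J ▸ hsup) (C := J)
      (smul_eq_zero_of_inf_eq_bot hinf) h

/-- If `𝔪 = I ⊕ J` with `I` and `J` nonzero, the vanishing of `Tor(M, C)` in an odd degree at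
least 3 and in an even positive degree, for a nonzero finite module `C` killed by `J`, gives
`Tor₁(M, 𝔪) = 0`. -/
theorem subsingleton_torModule_maximalIdeal (hinf : I ⊓ J = ⊥) (hsup : I ⊔ J = maximalIdeal R)
    (hI : I ≠ ⊥) (hJ : J ≠ ⊥) {M C : Type u} [AddCommGroup M] [Module R M] [AddCommGroup C]
    [Module R C] [Module.Finite R C] [Nontrivial C] (hC : ∀ y ∈ J, ∀ c : C, y • c = 0) (p q : ℕ)
    (hodd : Subsingleton (TorModule R (2 * p + 3) M C))
    (heven : Subsingleton (TorModule R (2 * q + 2) M C)) :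
    Subsingleton (TorModule R 1 M (maximalIdeal R)) := by
  have : Nontrivial J := Submodule.nontrivial_iff_ne_bot.2 hJ
  have hinf' : J ⊓ I = ⊥ := inf_comm I J ▸ hinf
  have hsup' : J ⊔ I = maximalIdeal R := sup_comm I J ▸ hsup
  -- The even degree reaches J in the odd degree 2q + 1; the odd one passes through J in degree 2p +
  -- 2 and reaches I in degree 2p + 1.
  have hTJ : Subsingleton (TorModule R 1 M J) :=
    subsingleton_torModule_ideal_odd hinf hsup hI hJ q
      (subsingleton_torModule_ideal_of_smul_eq_zero hinf hsup hC heven)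
  have hTI : Subsingleton (TorModule R 1 M I) :=
    subsingleton_torModule_ideal_odd hinf' hsup' hJ hI p
      (subsingleton_torModule_ideal_of_smul_eq_zero hinf' hsup' (C := J)
        (smul_eq_zero_of_inf_eq_bot hinf)
        (subsingleton_torModule_ideal_of_smul_eq_zero hinf hsup hC hodd))
  obtain ⟨e, he⟩ := exists_projection_maximalIdeal hinf hsup
  have hIm : I ≤ maximalIdeal R := hsup ▸ le_sup_left
  have hJm : J ≤ maximalIdeal R := hsup ▸ le_sup_right
  refine subsingleton_torModule_of_add_eq_id e (Submodule.inclusion hJm)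
    (((maximalIdeal R).subtype - J.subtype ∘ₗ e).codRestrict I he) (Submodule.inclusion hIm) ?_ 1
    hTJ hTI
  ext x
  exact add_sub_cancel (e x : R) (x : R)

/-- The vanishing theorem over a Noetherian local ring whose maximal ideal is the direct sum of two
nonzero ideals. -/
theorem projectiveDimension_le_one_or_of_maximalIdeal_eq_sup (hinf : I ⊓ J = ⊥)
    (hsup : I ⊔ J = maximalIdeal R) (hI : I ≠ ⊥) (hJ : J ≠ ⊥) {M N : Type u} [AddCommGroup M]
    [Module R M] [AddCommGroup N] [Module R N] [Module.Finite R M] [Module.Finite R N] (p q : ℕ)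
    (hodd : Subsingleton (TorModule R (2 * p + 5) M N))
    (heven : Subsingleton (TorModule R (2 * q + 4) M N)) :
    projectiveDimension (ModuleCat.of R M) ≤ 1 ∨ projectiveDimension (ModuleCat.of R N) ≤ 1 := by
  have hinf' : J ⊓ I = ⊥ := inf_comm I J ▸ hinf
  have hsup' : J ⊔ I = maximalIdeal R := sup_comm I J ▸ hsup
  -- Only the second cover has to be minimal, to put the coordinates of its kernel in 𝔪.
  obtain ⟨n, φ, hφ⟩ := Module.Finite.exists_fin' R N
  obtain ⟨l, ψ, hψ, hψm⟩ := exists_minimal_free_cover (R := R) (LinearMap.ker φ)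
  have shift : ∀ t, Subsingleton (TorModule R (t + 3) M N) →
      Subsingleton (TorModule R (t + 1) M (LinearMap.ker ψ)) := fun t ht =>
    subsingleton_torModule_of_exact (LinearMap.ker ψ).injective_subtype hψ
      (LinearMap.exact_subtype_ker_map ψ)
      (subsingleton_torModule_of_exact (LinearMap.ker φ).injective_subtype hφ
        (LinearMap.exact_subtype_ker_map φ) ht)
  have hodd' : Subsingleton (TorModule R (2 * p + 3) M (LinearMap.ker ψ)) := shift _ hodd
  have heven' : Subsingleton (TorModule R (2 * q + 2) M (LinearMap.ker ψ)) := shift _ heven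
  obtain ⟨fJ, rJ, hrJ, hJc⟩ := exists_retraction_coordinatesIn hinf hsup hψm
  obtain ⟨fI, rI, hrI, -⟩ := exists_retraction_coordinatesIn hinf' hsup' hψm
  rcases subsingleton_or_nontrivial ((LinearMap.ker ψ).coordinatesIn J) with hsJ | hntJ
  · rcases subsingleton_or_nontrivial ((LinearMap.ker ψ).coordinatesIn I) with hsI | hntI
    · right
      have hinj : Function.Injective ψ := by
        rw [injective_iff_map_eq_zero]
        intro v hv
        have hv' : v ∈ (LinearMap.ker ψ).coordinatesIn I :=
          Submodule.mem_coordinatesIn.2 ⟨hv, fun i => by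
            have := hJc ⟨v, hv⟩ i
            rwa [Subsingleton.elim (rJ ⟨v, hv⟩) 0, Submodule.coe_zero, Pi.zero_apply,
              sub_zero] at this⟩
        exact congrArg Subtype.val (Subsingleton.elim (⟨v, hv'⟩ : (LinearMap.ker ψ).coordinatesIn I) 0)
      have := Module.Projective.of_equiv (LinearEquiv.ofBijective ψ ⟨hinj, hψ⟩)
      exact projectiveDimension_le_one_of_exact (LinearMap.ker φ).injective_subtype hφ
        (LinearMap.exact_subtype_ker_map φ)
    · left
      exact projectiveDimension_le_one_of_torModule_maximalIdeal
        (subsingleton_torModule_maximalIdeal hinf hsup hI hJ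
          (Submodule.smul_coordinatesIn_eq_zero hinf' (LinearMap.ker ψ)) p q
          (subsingleton_torModule_of_retract fI rI hrI (2 * p + 3) hodd')
          (subsingleton_torModule_of_retract fI rI hrI (2 * q + 2) heven'))
  · left
    exact projectiveDimension_le_one_of_torModule_maximalIdeal
      (subsingleton_torModule_maximalIdeal hinf' hsup' hJ hI
        (Submodule.smul_coordinatesIn_eq_zero hinf (LinearMap.ker ψ)) p q
        (subsingleton_torModule_of_retract fJ rJ hrJ (2 * p + 3) hodd')
        (subsingleton_torModule_of_retract fJ rJ hrJ (2 * q + 2) heven'))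

end Decomposition

/-! ### The fiber product is Noetherian with decomposable maximal ideal -/

theorem isNoetherian_of_algebraMap_surjective {R : Type u} {A : Type v} [CommRing R] [CommRing A]
    [Algebra R A] [IsNoetherianRing A] (h : Function.Surjective (algebraMap R A)) :
    IsNoetherian R A := by
  refine ⟨fun s => ?_⟩
  rw [← Submodule.span_eq s, ← Submodule.restrictScalars_span R A h]
  exact (IsNoetherian.noetherian (R := A) _).restrictScalars_of_surjective h

section FiberProduct

variable {S : Type u} {T : Type v} {k : Type w} [CommRing S] [CommRing T] [Field k]
  {πS : S →+* k} {πT : T →+* k}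

/-- The fiber product embeds in S × T, a Noetherian module over it because it surjects onto both
factors. -/
theorem FiberProduct.isNoetherianRing [IsNoetherianRing S] [IsNoetherianRing T]
    (hπS : Function.Surjective πS) (hπT : Function.Surjective πT) :
    IsNoetherianRing (FiberProduct πS πT) := by
  let : Algebra (FiberProduct πS πT) S := (πS.pullbackFst πT).toAlgebra
  let : Algebra (FiberProduct πS πT) T := (πS.pullbackSnd πT).toAlgebra
  have : IsNoetherian (FiberProduct πS πT) S := isNoetherian_of_algebraMap_surjective
    (RingHom.surjective_pullbackFst_of_surjective πS πT hπT)
  have : IsNoetherian (FiberProduct πS πT) T := isNoetherian_of_algebraMap_surjective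
    (RingHom.surjective_pullbackSnd_of_surjective πS πT hπS)
  refine isNoetherian_of_injective ((Algebra.linearMap (FiberProduct πS πT) S).prod
    (Algebra.linearMap (FiberProduct πS πT) T)) fun x y h => Subtype.ext h

theorem FiberProduct.ker_inf_ker :
    RingHom.ker (πS.pullbackSnd πT) ⊓ RingHom.ker (πS.pullbackFst πT) = ⊥ := by
  rw [eq_bot_iff]
  exact fun x hx => Subtype.ext (Prod.ext hx.2 hx.1)

theorem FiberProduct.ker_sup_ker [IsLocalRing S] [IsLocalRing (FiberProduct πS πT)]
    (hπS : Function.Surjective πS) [IsLocalHom πT] :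
    RingHom.ker (πS.pullbackSnd πT) ⊔ RingHom.ker (πS.pullbackFst πT) =
      maximalIdeal (FiberProduct πS πT) := by
  refine le_antisymm (sup_le ?_ ?_) fun x hx => ?_
  · have : IsLocalHom πS := hπS.isLocalHom
    have : Nontrivial T := πT.domain_nontrivial
    exact le_maximalIdeal (RingHom.ker_ne_top _)
  · exact le_maximalIdeal (RingHom.ker_ne_top _)
  · have hx1 : πS x.1.1 = 0 := by
      rw [← RingHom.mem_ker, ker_eq_maximalIdeal πS hπS, mem_maximalIdeal, mem_nonunits_iff]
      exact fun h => hx (isUnit_of_map_unit (πS.pullbackFst πT) x h)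
    have hx2 : πT x.1.2 = 0 := x.2.symm.trans hx1
    -- Both components of x map to 0 in k, so (s, 0) and (0, t) lie in the fiber product.
    have hsum : x = ⟨(x.1.1, 0), by simpa using hx1⟩ + ⟨(0, x.1.2), by simpa using hx2.symm⟩ :=
      Subtype.ext (Prod.ext (add_zero _).symm (zero_add _).symm)
    rw [hsum]
    exact Submodule.add_mem_sup rfl rfl

theorem FiberProduct.ker_pullbackSnd_ne_bot (h : ¬ Function.Injective πS) :
    RingHom.ker (πS.pullbackSnd πT) ≠ ⊥ := by
  rw [injective_iff_map_eq_zero] at h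
  push Not at h
  obtain ⟨s, hs, hs0⟩ := h
  refine fun hbot => hs0 ?_
  have : (⟨(s, 0), by simpa using hs⟩ : FiberProduct πS πT) ∈ RingHom.ker (πS.pullbackSnd πT) := rfl
  rw [hbot, Ideal.mem_bot] at this
  exact congrArg (fun x => x.1.1) this

theorem FiberProduct.ker_pullbackFst_ne_bot (h : ¬ Function.Injective πT) :
    RingHom.ker (πS.pullbackFst πT) ≠ ⊥ := by
  rw [injective_iff_map_eq_zero] at h
  push Not at h
  obtain ⟨t, ht, ht0⟩ := h
  refine fun hbot => ht0 ?_
  have : (⟨(0, t), by simpa using ht.symm⟩ : FiberProduct πS πT) ∈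
    RingHom.ker (πS.pullbackFst πT) := rfl
  rw [hbot, Ideal.mem_bot] at this
  exact congrArg (fun x => x.1.2) this

end FiberProduct

theorem mainTheorem4 {S : Type u} {T : Type v} {k : Type w}
    [CommRing S] [IsLocalRing S] [IsNoetherianRing S]
    [CommRing T] [IsLocalRing T] [IsNoetherianRing T]
    [Field k]
    (πS : S →+* k) (πT : T →+* k)
    (hπS : Function.Surjective πS) (hπT : Function.Surjective πT)
    (hS : ¬ Function.Bijective πS) (hT : ¬ Function.Bijective πT)
    (M N : Type (max u v)) [AddCommGroup M] [AddCommGroup N]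
    [Module (FiberProduct πS πT) M] [Module (FiberProduct πS πT) N]
    [Module.Finite (FiberProduct πS πT) M] [Module.Finite (FiberProduct πS πT) N]
    (i j : ℕ) (hi : 2 ≤ i) (hj : 3 ≤ j)
    (hodd : Subsingleton (TorModule (FiberProduct πS πT) (2 * i + 1) M N))
    (heven : Subsingleton (TorModule (FiberProduct πS πT) (2 * j) M N)) :
    CategoryTheory.projectiveDimension (ModuleCat.of (FiberProduct πS πT) M) ≤ 1 ∨
      CategoryTheory.projectiveDimension (ModuleCat.of (FiberProduct πS πT) N) ≤ 1 := by
  have : IsLocalHom πT := hπT.isLocalHom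
  have : IsLocalRing (FiberProduct πS πT) := RingHom.isLocalRing_pullback πS πT
  have : IsNoetherianRing (FiberProduct πS πT) := FiberProduct.isNoetherianRing hπS hπT
  have h₁ : ∃ p, 2 * i + 1 = 2 * p + 5 := ⟨i - 2, by lia⟩
  have h₂ : ∃ q, 2 * j = 2 * q + 4 := ⟨j - 2, by lia⟩
  obtain ⟨p, hp⟩ := h₁
  obtain ⟨q, hq⟩ := h₂
  have hodd' : Subsingleton (TorModule (FiberProduct πS πT) (2 * p + 5) M N) := hp ▸ hodd
  have heven' : Subsingleton (TorModule (FiberProduct πS πT) (2 * q + 4) M N) := hq ▸ heven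
  have h := projectiveDimension_le_one_or_of_maximalIdeal_eq_sup (R := FiberProduct πS πT)
    FiberProduct.ker_inf_ker (FiberProduct.ker_sup_ker hπS)
    (FiberProduct.ker_pullbackSnd_ne_bot fun h => hS ⟨h, hπS⟩)
    (FiberProduct.ker_pullbackFst_ne_bot fun h => hT ⟨h, hπT⟩) (M := M) (N := N) p q hodd' heven'
  exact h
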